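/- Let $\mathcal{A}=(A,X,\lambda,\mu)$ be a finite invertible automaton: $A$ (states) and $X$ (alphabet) are finite sets, $s\cdot x=\lambda(s,x)\in A$, $s\circ x=\mu(s,x)\in X$, and $s\circ$ is a permutation of $X$ for every $s\in A$. Let $\widetilde A=A\cup A^{-1}$, where $s^{-1}\circ y=x$ and $s^{-1}\cdot y=(s\cdot x)^{-1}$ whenever $s\circ x=y$. Extend the two maps to letters $a\in\widetilde A$ and words over $X$ by $a\circ(xu)=(a\circ x)\,((a\cdot x)\circ u)$, $a\cdot(xu)=(a\cdot x)\cdot u$, and to words over $\widetilde A$ by $(aw)\circ u=w\circ(a\circ u)$, $(aw)\cdot u=(a\cdot u)\,(w\cdot(a\circ u))$. The group $G(\mathcal{A})$ is the group of bijections of $X^*$ generated by the maps $s\circ$, $s\in A$ (products being read from left to right), and $\omega:\widetilde A^*\to G(\mathcal{A})$ is the canonical morphism. Let $F_A$ be the free group on $A$, in which a sink state (a state $s$ with $s\circ x=x$ and $s\cdot x=s$ for all $x\in X$) is identified with $\mathbf 1$, let $\theta:\widetilde A^*\to F_A$ be the canonical morphism, and let $|g|$ be the word length of $g\in F_A$;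 the maps $\circ$ and $\cdot$ are defined on $F_A$ through reduced words. The automaton $\mathcal{A}$ is *reducible* if for every $g\in F_A$ with $g\neq\mathbf 1$ and $g\circ x=x$ for some $x\in X$ there is an integer $n$ such that $|g\cdot u|<|g|$ for all words $u$ over $X$ of length at least $n$. For $k>0$, the language of *$k$-fragile words* $\mathcal{F}_k\subseteq\widetilde A^*$ consists of all words $w\in\widetilde A^*$ such that $\omega(w)$ fixes every word in $X^k$, and $\theta(w\cdot u)=\mathbf 1$ for all words $u$ over $X$ of length at least $k$. A language is *deterministic $n$-context-free* if it is the intersection of $n$ deterministic context-free languages (languages accepted by final state by a deterministic pushdown automaton). **Proposition.** Let $\mathcal{A}$ be a reducible automaton. Then, for every $k>0$, the language $\mathcal{F}_k$ is deterministic $|X|^k$-context-free. Moreover, the word problem of $G(\mathcal{A})$, that is, the language of all $w\in\widetilde A^*$ with $\omega(w)=1$, is $$\{w\in\widetilde A^*:\omega(w)=1\}=\bigcup_{k>0}\mathcal{F}_k.$$ -/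

import Mathlib

/-! ### Deterministic context-free languages -/

/-- A pushdown automaton over the input alphabet `α`, with states `Q` and stack symbols `Γ`, that is
deterministic: in state `q`, with `Z` on top of the stack, there is at most one move on each input
letter `a` (`step q (some a) Z`) and at most one `ε`-move (`step q none Z`), and if there is an
`ε`-move, then there is no move that reads a letter. A move `some (q', β)` goes to the state `q'` and
replaces the top symbol `Z` by the string `β`, whose first letter becomes the top symbol. -/
structure DetPushdown (α Q Γ : Type*) where
  step : Q → Option α → Γ → Option (Q × List Γ)
  start : Q
  bottom : Γ
  accept : Set Q
  deterministic : ∀ q Z, step q none Z ≠ none → ∀ a, step q (some a) Z = none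

namespace DetPushdown

variable {α Q Γ : Type*}

/-- One move between configurations (state, unread input, stack with its top first). -/
inductive Move (P : DetPushdown α Q Γ) : Q × List α × List Γ → Q × List α × List Γ → Prop
  | read {q q' : Q} {a : α} {w : List α} {Z : Γ} {β γ : List Γ}
      (h : P.step q (some a) Z = some (q', β)) : Move P (q, a :: w, Z :: γ) (q', w, β ++ γ)
  | eps {q q' : Q} {w : List α} {Z : Γ} {β γ : List Γ}
      (h : P.step q none Z = some (q', β)) : Move P (q, w, Z :: γ) (q', w, β ++ γ)

/-- The language accepted by final state. -/
def language (P : DetPushdown α Q Γ) : Language α :=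
  {w | ∃ q ∈ P.accept, ∃ γ : List Γ,
    Relation.ReflTransGen P.Move (P.start, w, [P.bottom]) (q, [], γ)}

end DetPushdown

/-- Deterministic context-free languages: those accepted by a deterministic pushdown automaton with
finitely many states and stack symbols. -/
def Language.IsDetContextFree {α : Type*} (L : Language α) : Prop :=
  ∃ (Q Γ : Type) (_ : Finite Q) (_ : Finite Γ) (P : DetPushdown α Q Γ), P.language = L

/-- Deterministic `n`-context-free languages: intersections of `n` deterministic context-free
languages. -/
def Language.IsDetMultiContextFree {α : Type*} (n : ℕ) (L : Language α) : Prop :=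
  ∃ K : Fin n → Language α, (∀ i, (K i).IsDetContextFree) ∧ ∀ w, w ∈ L ↔ ∀ i, w ∈ K i

/-! ### Automaton groups -/

/-- An invertible automaton with states `A` and alphabet `X`: the restriction map
`restr s x = s · x`, and the output map `out s x = s ∘ x`, which is a permutation of `X` for every
state `s`. -/
structure InvertibleAutomaton (A X : Type*) where
  restr : A → X → A
  out : A → Equiv.Perm X

namespace InvertibleAutomaton

variable {A X : Type*} (M : InvertibleAutomaton A X)

/-- The action `a ∘ x` of a letter `a` of the alphabet `A ∪ A⁻¹`, where `(s, true)` stands for `s`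
and `(s, false)` for `s⁻¹`. -/
def letterOut : A × Bool → X → X
  | (s, true), x => M.out s x
  | (s, false), y => (M.out s).symm y

/-- The restriction `a · x` of a letter of `A ∪ A⁻¹`: if `s ∘ x = y` and `s · x = t`, then
`s⁻¹ ∘ y = x` and `s⁻¹ · y = t⁻¹`. -/
def letterRestr : A × Bool → X → A × Bool
  | (s, true), x => (M.restr s x, true)
  | (s, false), y => (M.restr s ((M.out s).symm y), false)

/-- `a ∘ u` for a letter `a` of `A ∪ A⁻¹` and a word `u` over `X`. -/
def letterAct : A × Bool → List X → List X
  | _, [] => []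
  | a, x :: u => M.letterOut a x :: letterAct (M.letterRestr a x) u

/-- `a · u` for a letter `a` of `A ∪ A⁻¹` and a word `u` over `X`. -/
def letterRes : A × Bool → List X → A × Bool
  | a, [] => a
  | a, x :: u => letterRes (M.letterRestr a x) u

/-- `w ∘ u` for a word `w` over `A ∪ A⁻¹`; the first letter of `w` acts first. -/
def wordAct : List (A × Bool) → List X → List X
  | [], u => u
  | a :: w, u => wordAct w (M.letterAct a u)

/-- `w · u` for a word `w` over `A ∪ A⁻¹`, again a word over `A ∪ A⁻¹`. -/
def wordRes : List (A × Bool) → List X → List (A × Bool)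
  | [], _ => []
  | a :: w, u => M.letterRes a u :: wordRes w (M.letterAct a u)

theorem letterAct_cancel (s : A) (b : Bool) (u : List X) :
    M.letterAct (s, !b) (M.letterAct (s, b) u) = u := by
  induction u generalizing s with
  | nil => rfl
  | cons x u ih =>
    cases b
    · simpa [letterAct, letterOut, letterRestr] using ih (M.restr s ((M.out s).symm x))
    · simpa [letterAct, letterOut, letterRestr] using ih (M.restr s x)

/-- The bijective transformation of `X^*` given by a state. -/
def statePerm (s : A) : Equiv.Perm (List X) where
  toFun := M.letterAct (s, true)
  invFun := M.letterAct (s, false)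
  left_inv := M.letterAct_cancel s true
  right_inv := M.letterAct_cancel s false

/-- The automaton group: the group of transformations of `X^*` generated by the states. The opposite
group structure is used since products are read from left to right, `(g h) ∘ u = h ∘ (g ∘ u)`. -/
def group : Subgroup (Equiv.Perm (List X))ᵐᵒᵖ :=
  Subgroup.closure (Set.range fun s => MulOpposite.op (M.statePerm s))

/-- The generator of the automaton group given by a state. -/
def gen (s : A) : M.group :=
  ⟨MulOpposite.op (M.statePerm s), Subgroup.subset_closure ⟨s, rfl⟩⟩

/-- The canonical morphism from words over `A ∪ A⁻¹` to the automaton group. -/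
def toGroup (w : List (A × Bool)) : M.group :=
  (w.map fun a => if a.2 then M.gen a.1 else (M.gen a.1)⁻¹).prod

/-- The stabilizer in the automaton group of the `k`-th level of the tree `X^*`. -/
def levelStabilizer (k : ℕ) : Subgroup M.group where
  carrier := {g | ∀ v : List X, v.length = k → g.1.unop v = v}
  one_mem' := fun _ _ => rfl
  mul_mem' := by
    intro g h hg hh v hv
    change h.1.unop (g.1.unop v) = v
    rw [hg v hv, hh v hv]
  inv_mem' := by
    intro g hg v hv
    change (g.1.unop).symm v = v
    rw [Equiv.symm_apply_eq, hg v hv]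

/-- The word problem of the automaton group: the words over `A ∪ A⁻¹` that represent `1`. -/
def wordProblem : Language (A × Bool) :=
  {w | M.toGroup w = 1}

/-! ### Reducible automata and fragile words -/

/-- A sink: a state with trivial output all of whose restrictions are the state itself. -/
def IsSink (s : A) : Prop :=
  ∀ x, M.out s x = x ∧ M.restr s x = s

/-- The free group `F_A` on the states, where a sink state is identified with `1`; that is, the
free group on the states that are not sinks. -/
abbrev FreeGrp : Type _ := FreeGroup {s : A // ¬ M.IsSink s}

open Classical in
/-- The canonical morphism `θ` from words over `A ∪ A⁻¹` to `F_A`; it sends a sink to `1`. -/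
noncomputable def theta (w : List (A × Bool)) : M.FreeGrp :=
  (w.map fun a => if h : M.IsSink a.1 then 1 else FreeGroup.mk [(⟨a.1, h⟩, a.2)]).prod

open Classical in
/-- The reduced word, over `A ∪ A⁻¹`, of an element of `F_A`. -/
noncomputable def reducedWord (g : M.FreeGrp) : List (A × Bool) :=
  g.toWord.map fun a => (a.1.1, a.2)

open Classical in
/-- The word length on `F_A`. -/
noncomputable def len (g : M.FreeGrp) : ℕ := FreeGroup.norm g

/-- The map `λ(g, u) = g · u` on `F_A`. -/
noncomputable def freeRes (g : M.FreeGrp) (u : List X) : M.FreeGrp :=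
  M.theta (M.wordRes (M.reducedWord g) u)

/-- The map `μ(g, u) = g ∘ u` on `F_A`. -/
noncomputable def freeAct (g : M.FreeGrp) (u : List X) : List X :=
  M.wordAct (M.reducedWord g) u

/-- Reducible automata: every nontrivial `g` in `F_A` that fixes some letter becomes strictly
shorter by restriction to all sufficiently long words. -/
def IsReducible : Prop :=
  ∀ g : M.FreeGrp, g ≠ 1 → (∃ x : X, M.freeAct g [x] = [x]) →
    ∃ n : ℕ, ∀ u : List X, n ≤ u.length → M.len (M.freeRes g u) < M.len g

/-- The language of `k`-fragile words. -/
def fragileWords (k : ℕ) : Language (A × Bool) :=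
  {w | M.toGroup w ∈ M.levelStabilizer k ∧
    ∀ u : List X, k ≤ u.length → M.theta (M.wordRes w u) = 1}

end InvertibleAutomaton

/-! The free group `F_A` acts on `List X × F_A`: a letter `a` sends `(u, h)` to `(a ∘ u, h θ(a ·
u))` (`cocycleHom`). Hence `w ∘ u` and `θ(w · u)` depend only on `θ(w)`, and once `θ(w · v) = 1`,
the word `w` acts trivially below `v` and all further restrictions stay trivial.

So `k`-fragility need only be tested on the `|X|^k` words `v` of length exactly `k`
(`mem_fragileWords_iff`). For fixed `v`, a deterministic pushdown automaton tests it: the finite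
control follows the image of `v`, and the stack keeps the reduced word of the inverse of the
restriction read so far (`mem_language_pushdown`).

Fragile words act trivially by the first remark. Conversely, if `w` acts trivially, so do all its
restrictions; reducibility shortens them at some level, and strong induction on `|θ(w)|` together
with finiteness of `X` gives a uniform `k` (`exists_theta_wordRes_eq_one`). -/

namespace DetPushdown

/-! ### Change of states and stack symbols -/

variable {α Q Γ Q' Γ' : Type*}

/-- Renaming the states and the stack symbols of a deterministic pushdown automaton. -/
def rename (P : DetPushdown α Q Γ) (e : Q ≃ Q') (f : Γ ≃ Γ') : DetPushdown α Q' Γ' where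
  step q a Z := (P.step (e.symm q) a (f.symm Z)).map fun p => (e p.1, p.2.map f)
  start := e P.start
  bottom := f P.bottom
  accept := e.symm ⁻¹' P.accept
  deterministic q Z h a := by
    simp only [ne_eq, Option.map_eq_none_iff] at h ⊢
    exact P.deterministic _ _ h a

theorem Move.rename {P : DetPushdown α Q Γ} (e : Q ≃ Q') (f : Γ ≃ Γ') {c d : Q × List α × List Γ}
    (h : P.Move c d) :
    (P.rename e f).Move (e c.1, c.2.1, c.2.2.map f) (e d.1, d.2.1, d.2.2.map f) := by
  cases h with
  | read h =>
    simp only [List.map_cons, List.map_append]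
    exact .read (by simp [DetPushdown.rename, h])
  | eps h =>
    simp only [List.map_cons, List.map_append]
    exact .eps (by simp [DetPushdown.rename, h])

theorem language_le_rename (P : DetPushdown α Q Γ) (e : Q ≃ Q') (f : Γ ≃ Γ') {w : List α}
    (hw : w ∈ P.language) : w ∈ (P.rename e f).language := by
  obtain ⟨q, hq, γ, h⟩ := hw
  refine ⟨e q, by simpa [rename] using hq, γ.map f, ?_⟩
  exact h.lift (fun c => (e c.1, c.2.1, c.2.2.map f)) fun _ _ h => h.rename e f

theorem rename_rename_symm (P : DetPushdown α Q Γ) (e : Q ≃ Q') (f : Γ ≃ Γ') :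
    (P.rename e f).rename e.symm f.symm = P := by
  rcases P with ⟨step, start, bottom, accept, det⟩
  simp [rename, Function.comp_def, Set.preimage]

theorem language_rename (P : DetPushdown α Q Γ) (e : Q ≃ Q') (f : Γ ≃ Γ') :
    (P.rename e f).language = P.language := by
  ext w
  refine ⟨fun h => ?_, P.language_le_rename e f⟩
  have := (P.rename e f).language_le_rename e.symm f.symm h
  rwa [rename_rename_symm] at this

/-- Renaming to `Fin n` removes the universe restriction in `IsDetContextFree`. -/
theorem isDetContextFree [Finite Q] [Finite Γ] (P : DetPushdown α Q Γ) :
    P.language.IsDetContextFree :=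
  ⟨_, _, inferInstance, inferInstance, P.rename (Finite.equivFin Q) (Finite.equivFin Γ),
    P.language_rename _ _⟩

end DetPushdown

/-! ### Transducers with values in a free group -/

/-- The word `x` consisting of at most one letter, as an element of the free group. -/
def FreeGroup.ofOptionLetter {S : Type*} (x : Option (S × Bool)) : FreeGroup S :=
  x.elim 1 fun y => FreeGroup.mk [y]

open Classical in
theorem FreeGroup.toWord_mk_inv_mul {S : Type*} (x : S × Bool) (h : FreeGroup S) :
    ((FreeGroup.mk [x])⁻¹ * h).toWord =
      if h.toWord.head? = some x then h.toWord.tail else (x.1, !x.2) :: h.toWord := by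
  have h1 : (FreeGroup.mk [x])⁻¹ * h = FreeGroup.mk ((x.1, !x.2) :: h.toWord) := by
    conv_lhs => rw [← FreeGroup.mk_toWord (x := h)]
    simp [FreeGroup.inv_mk, FreeGroup.invRev]
  rw [h1, FreeGroup.toWord_mk, FreeGroup.reduce.cons, FreeGroup.reduce_toWord]
  rcases x with ⟨s, b⟩
  rcases h.toWord with _ | ⟨⟨t, c⟩, l⟩
  · simp
  · simp only [List.head?_cons, Option.some.injEq, Prod.mk.injEq, List.tail_cons, Bool.not_inj_iff]
    congr 1
    exact propext ⟨fun h => ⟨h.1.symm, h.2.symm⟩, fun h => ⟨h.1.symm, h.2.symm⟩⟩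

/-- A deterministic letter-to-letter transducer with inputs in `α` and outputs in the free group
on `S`. -/
structure FreeTransducer (α Q S : Type*) where
  next : Q → α → Q
  out : Q → α → Option (S × Bool)

namespace FreeTransducer

variable {α Q S : Type*} (T : FreeTransducer α Q S)

/-- The product of the outputs along a word. -/
def output : Q → List α → FreeGroup S
  | _, [] => 1
  | q, a :: w => FreeGroup.ofOptionLetter (T.out q a) * output (T.next q a) w

open Classical in
/-- The pushdown automaton that stores the reduced word of the inverse of the output: its first
letter in the finite control, the others on the stack. -/
noncomputable def pushdown (q₀ : Q) (F : Set Q) :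
    DetPushdown α (Q × Option (S × Bool)) (Option (S × Bool)) where
  step
    | _, none, _ => none
    -- Keeping the first letter `t` in the control makes emptiness of the reduced word visible in
    -- the state, so acceptance needs no `ε`-moves. On cancellation the stack top becomes the new
    -- first letter; the bottom marker `none` is put back and leaves the register empty.
    | (q, t), some a, Z => some <| match T.out q a with
      | none => ((T.next q a, t), [Z])
      | some x =>
        if t = some x then ((T.next q a, Z), Z.elim [none] fun _ => [])
        else ((T.next q a, some (x.1, !x.2)), t.toList.map some ++ [Z])
  start := (q₀, none)
  bottom := none
  accept := {p | p.1 ∈ F ∧ p.2 = none}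
  deterministic _ _ h := (h rfl).elim

open Classical in
/-- The configuration in which the reduced word of `h` is stored. -/
noncomputable def config (q : Q) (w : List α) (h : FreeGroup S) :
    (Q × Option (S × Bool)) × List α × List (Option (S × Bool)) :=
  ((q, h.toWord.head?), w, h.toWord.tail.map some ++ [none])

theorem move_config_cons (q₀ : Q) (F : Set Q) (q : Q) (a : α) (w : List α) (h : FreeGroup S)
    (c : (Q × Option (S × Bool)) × List α × List (Option (S × Bool))) :
    (T.pushdown q₀ F).Move (config q (a :: w) h) c ↔
      c = config (T.next q a) w ((FreeGroup.ofOptionLetter (T.out q a))⁻¹ * h) := by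
  classical
  -- The bottom marker is never lost, so a move always finds a top symbol.
  obtain ⟨Z, γ, hZ⟩ : ∃ Z γ, h.toWord.tail.map some ++ [none] = Z :: γ := by
    cases h.toWord.tail <;> simp
  obtain ⟨q', β, hs, hc⟩ : ∃ q' β,
      (T.pushdown q₀ F).step (q, h.toWord.head?) (some a) Z = some (q', β) ∧
      config (T.next q a) w ((FreeGroup.ofOptionLetter (T.out q a))⁻¹ * h) = (q', w, β ++ γ) := by
    refine ⟨_, _, rfl, ?_⟩
    rcases hx : T.out q a with _ | x
    · simp only [config, FreeGroup.ofOptionLetter, Option.elim_none, inv_one, one_mul, hZ]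
      rfl
    · simp only [FreeGroup.ofOptionLetter, Option.elim_some, config,
        FreeGroup.toWord_mk_inv_mul]
      rcases hr : h.toWord with _ | ⟨y, _ | ⟨z, l⟩⟩ <;> rw [hr] at hZ <;>
        simp only [List.tail_nil, List.tail_cons, List.map_nil, List.map_cons, List.nil_append,
          List.cons_append, List.cons.injEq] at hZ <;> obtain ⟨rfl, rfl⟩ := hZ
      · simp
      all_goals by_cases hy : y = x <;> simp [hy]
  rw [hc]
  unfold config
  rw [hZ]
  constructor
  · rintro (h' | h')
    · rw [hs] at h'
      cases h'
      rfl
    · cases h'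
  · rintro rfl
    exact .read hs

/-- Each move is forced and reads one letter, so the run is unique. Inverses are stored because `(g
x)⁻¹ = x⁻¹ g⁻¹` changes only the head of the reduced word. -/
theorem reach_config (q₀ : Q) (F : Set Q) (q : Q) (w : List α) (h : FreeGroup S)
    (p : Q × Option (S × Bool)) (γ : List (Option (S × Bool))) :
    Relation.ReflTransGen (T.pushdown q₀ F).Move (config q w h) (p, [], γ) ↔
      (p, [], γ) = config (w.foldl T.next q) ([] : List α) ((T.output q w)⁻¹ * h) := by
  induction w generalizing q h with
  | nil =>
    rw [Relation.ReflTransGen.cases_head_iff]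
    simp only [List.foldl_nil, output, inv_one, one_mul]
    constructor
    · rintro (h' | ⟨c, h', -⟩)
      · exact h'.symm
      · unfold config at h'
        -- The stack must be a variable for the case analysis on the move; with no input left, only
        -- an `ε`-move could apply, and there is none.
        generalize List.map some (List.tail _) ++ [none] = l at h'
        rcases h' with _ | h'
        cases h'
    · exact fun h' => .inl h'.symm
  | cons a w ih =>
    rw [Relation.ReflTransGen.cases_head_iff]
    simp only [move_config_cons, exists_eq_left, ih, List.foldl_cons, output, mul_inv_rev,
      mul_assoc]
    exact or_iff_right fun h' => by simp [config] at h'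

theorem mem_language_pushdown (q₀ : Q) (F : Set Q) (w : List α) :
    w ∈ (T.pushdown q₀ F).language ↔ w.foldl T.next q₀ ∈ F ∧ T.output q₀ w = 1 := by
  classical
  have h0 : ((T.pushdown q₀ F).start, w, [(T.pushdown q₀ F).bottom]) =
      config q₀ w (1 : FreeGroup S) := by simp [config, pushdown]
  have key (p γ) := T.reach_config q₀ F q₀ w 1 p γ
  rw [← h0] at key
  change (∃ p ∈ (T.pushdown q₀ F).accept, ∃ γ, Relation.ReflTransGen (T.pushdown q₀ F).Move
    ((T.pushdown q₀ F).start, w, [(T.pushdown q₀ F).bottom]) (p, [], γ)) ↔ _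
  simp only [key, mul_one, config, Prod.mk.injEq, true_and]
  constructor
  · rintro ⟨p, ⟨hF, hp⟩, γ, rfl, -⟩
    refine ⟨hF, ?_⟩
    rwa [List.head?_eq_none_iff, FreeGroup.toWord_eq_nil_iff, inv_eq_one] at hp
  · rintro ⟨hF, h1⟩
    exact ⟨_, ⟨hF, by simp [h1]⟩, _, rfl, rfl⟩

theorem isDetContextFree [Finite Q] [Finite S] (q₀ : Q) (F : Set Q) :
    Language.IsDetContextFree
      ({w | w.foldl T.next q₀ ∈ F ∧ T.output q₀ w = 1} : Language α) := by
  have h := (T.pushdown q₀ F).isDetContextFree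
  rwa [show (T.pushdown q₀ F).language = _ from Set.ext (T.mem_language_pushdown q₀ F)] at h

end FreeTransducer

namespace InvertibleAutomaton

variable {A X : Type*} (M : InvertibleAutomaton A X)

/-! ### Actions and restrictions of words -/

@[simp] theorem length_letterAct (a : A × Bool) (u : List X) :
    (M.letterAct a u).length = u.length := by
  induction u generalizing a with
  | nil => rfl
  | cons x u ih => simp [letterAct, ih]

theorem letterAct_append (a : A × Bool) (u v : List X) :
    M.letterAct a (u ++ v) = M.letterAct a u ++ M.letterAct (M.letterRes a u) v := by
  induction u generalizing a with
  | nil => rfl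
  | cons x u ih => simp [letterAct, letterRes, ih]

theorem letterRes_append (a : A × Bool) (u v : List X) :
    M.letterRes a (u ++ v) = M.letterRes (M.letterRes a u) v := by
  induction u generalizing a with
  | nil => rfl
  | cons x u ih => simp [letterRes, ih]

@[simp] theorem length_wordAct (w : List (A × Bool)) (u : List X) :
    (M.wordAct w u).length = u.length := by
  induction w generalizing u with
  | nil => rfl
  | cons a w ih => simp [wordAct, ih]

theorem wordAct_append (w : List (A × Bool)) (u v : List X) :
    M.wordAct w (u ++ v) = M.wordAct w u ++ M.wordAct (M.wordRes w u) v := by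
  induction w generalizing u v with
  | nil => rfl
  | cons a w ih => simp [wordAct, wordRes, letterAct_append, ih]

theorem wordRes_append (w : List (A × Bool)) (u v : List X) :
    M.wordRes w (u ++ v) = M.wordRes (M.wordRes w u) v := by
  induction w generalizing u v with
  | nil => rfl
  | cons a w ih => simp [wordRes, letterAct_append, letterRes_append, ih]

/-- With `letterAct_cancel`, this makes `cocycleMap` invertible, as an action of the free group
requires. -/
theorem letterRes_cancel (s : A) (b : Bool) (u : List X) :
    M.letterRes (s, !b) (M.letterAct (s, b) u) =
      ((M.letterRes (s, b) u).1, !(M.letterRes (s, b) u).2) := by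
  induction u generalizing s with
  | nil => rfl
  | cons x u ih =>
    cases b
    · simpa [letterAct, letterRes, letterOut, letterRestr] using ih (M.restr s ((M.out s).symm x))
    · simpa [letterAct, letterRes, letterOut, letterRestr] using ih (M.restr s x)

variable {M} in
theorem IsSink.letterOut_eq {s : A} (hs : M.IsSink s) (b : Bool) (x : X) :
    M.letterOut (s, b) x = x := by
  cases b
  · exact (Equiv.symm_apply_eq _).2 (hs x).1.symm
  · exact (hs x).1

variable {M} in
theorem IsSink.letterRestr_eq {s : A} (hs : M.IsSink s) (b : Bool) (x : X) :
    M.letterRestr (s, b) x = (s, b) := by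
  cases b
  · simp [letterRestr, (hs _).2]
  · simp [letterRestr, (hs x).2]

variable {M} in
theorem IsSink.letterAct_eq {s : A} (hs : M.IsSink s) (b : Bool) (u : List X) :
    M.letterAct (s, b) u = u := by
  induction u with
  | nil => rfl
  | cons x u ih => simp [letterAct, hs.letterOut_eq, hs.letterRestr_eq, ih]

variable {M} in
theorem IsSink.letterRes_eq {s : A} (hs : M.IsSink s) (b : Bool) (u : List X) :
    M.letterRes (s, b) u = (s, b) := by
  induction u with
  | nil => rfl
  | cons x u ih => simp [letterRes, hs.letterRestr_eq, ih]

theorem toGroup_unop_apply (w : List (A × Bool)) (u : List X) :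
    (M.toGroup w).1.unop u = M.wordAct w u := by
  induction w generalizing u with
  | nil => rfl
  | cons a w ih =>
    have h : M.toGroup (a :: w) = (if a.2 then M.gen a.1 else (M.gen a.1)⁻¹) * M.toGroup w := by
      simp [toGroup]
    rw [h, wordAct, ← ih]
    rcases a with ⟨s, _ | _⟩ <;> rfl

theorem mem_wordProblem_iff (w : List (A × Bool)) :
    w ∈ M.wordProblem ↔ ∀ u, M.wordAct w u = u := by
  change M.toGroup w = 1 ↔ _
  simp only [← toGroup_unop_apply]
  constructor
  · intro h u
    rw [h]
    rfl
  · intro h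
    exact Subtype.ext (MulOpposite.unop_injective (Equiv.ext h))

/-! ### The maps on the free group -/

@[simp] theorem theta_nil : M.theta [] = 1 := rfl

theorem theta_cons (a : A × Bool) (w : List (A × Bool)) :
    M.theta (a :: w) = M.theta [a] * M.theta w := by
  simp [theta]

variable {M} in
theorem IsSink.theta_eq {s : A} (hs : M.IsSink s) (b : Bool) : M.theta [(s, b)] = 1 := by
  simp [theta, hs]

theorem theta_singleton_of_not_isSink {s : A} (hs : ¬ M.IsSink s) (b : Bool) :
    M.theta [(s, b)] = FreeGroup.mk [(⟨s, hs⟩, b)] := by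
  simp [theta, hs]

theorem theta_singleton_mul_not (s : A) (b : Bool) :
    M.theta [(s, b)] * M.theta [(s, !b)] = 1 := by
  by_cases hs : M.IsSink s
  · simp [hs.theta_eq]
  · rw [M.theta_singleton_of_not_isSink hs, M.theta_singleton_of_not_isSink hs,
      mul_eq_one_iff_inv_eq]
    simp [FreeGroup.inv_mk, FreeGroup.invRev]

theorem theta_reducedWord (g : M.FreeGrp) : M.theta (M.reducedWord g) = g := by
  classical
  have h (L : List ({s : A // ¬ M.IsSink s} × Bool)) :
      M.theta (L.map fun a => (a.1.1, a.2)) = FreeGroup.mk L := by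
    induction L with
    | nil => rfl
    | cons a L ih =>
      rw [List.map_cons, theta_cons, ih, M.theta_singleton_of_not_isSink a.1.2,
        FreeGroup.mul_mk]
      rfl
  rw [reducedWord, h]
  convert FreeGroup.mk_toWord

/-- The map given by a letter on pairs of a word over `X` and an element of `F_A` that accumulates
the restrictions. -/
noncomputable def cocycleMap (a : A × Bool) (p : List X × M.FreeGrp) : List X × M.FreeGrp :=
  (M.letterAct a p.1, p.2 * M.theta [M.letterRes a p.1])

theorem cocycleMap_cancel (s : A) (b : Bool) (p : List X × M.FreeGrp) :
    M.cocycleMap (s, !b) (M.cocycleMap (s, b) p) = p := by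
  simp only [cocycleMap, letterAct_cancel, letterRes_cancel]
  rw [mul_assoc, theta_singleton_mul_not, mul_one]

/-- The permutation given by `cocycleMap` for a state. -/
noncomputable def cocyclePerm (s : A) : Equiv.Perm (List X × M.FreeGrp) where
  toFun := M.cocycleMap (s, true)
  invFun := M.cocycleMap (s, false)
  left_inv := M.cocycleMap_cancel s true
  right_inv := M.cocycleMap_cancel s false

/-- The action of `F_A` that extends `cocyclePerm`. -/
noncomputable def cocycleHom : M.FreeGrp →* (Equiv.Perm (List X × M.FreeGrp))ᵐᵒᵖ :=
  FreeGroup.lift fun s => MulOpposite.op (M.cocyclePerm s.1)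

theorem cocycleHom_theta_singleton (a : A × Bool) (p : List X × M.FreeGrp) :
    (M.cocycleHom (M.theta [a])).unop p = M.cocycleMap a p := by
  rcases a with ⟨s, b⟩
  by_cases hs : M.IsSink s
  -- A sink fixes all words and restricts to itself, so it acts as the identity, in agreement with
  -- its being identified with `1`.
  · simp [hs.theta_eq, cocycleMap, hs.letterAct_eq, hs.letterRes_eq]
  · rw [M.theta_singleton_of_not_isSink hs, cocycleHom, FreeGroup.lift_mk]
    cases b
    · simp only [List.map_cons, List.map_nil, List.prod_singleton, cond_false]
      rfl
    · simp only [List.map_cons, List.map_nil, List.prod_singleton, cond_true]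
      rfl

theorem cocycleHom_theta (w : List (A × Bool)) (u : List X) (h : M.FreeGrp) :
    (M.cocycleHom (M.theta w)).unop (u, h) =
      (M.wordAct w u, h * M.theta (M.wordRes w u)) := by
  induction w generalizing u h with
  | nil => simp [wordAct, wordRes]
  | cons a w ih =>
    rw [theta_cons, map_mul, MulOpposite.unop_mul, Equiv.Perm.mul_apply,
      cocycleHom_theta_singleton, cocycleMap, ih, wordRes, wordAct,
      M.theta_cons (M.letterRes a u) (M.wordRes w _), mul_assoc]

theorem wordAct_congr {w w' : List (A × Bool)} (h : M.theta w = M.theta w') (u : List X) :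
    M.wordAct w u = M.wordAct w' u := by
  have h1 := M.cocycleHom_theta w u 1
  rw [h, cocycleHom_theta] at h1
  exact (Prod.ext_iff.1 h1).1.symm

theorem theta_wordRes_congr {w w' : List (A × Bool)} (h : M.theta w = M.theta w') (u : List X) :
    M.theta (M.wordRes w u) = M.theta (M.wordRes w' u) := by
  have h1 := M.cocycleHom_theta w u 1
  rw [h, cocycleHom_theta] at h1
  simpa using (Prod.ext_iff.1 h1).2.symm

theorem wordAct_of_theta_eq_one {w : List (A × Bool)} (h : M.theta w = 1) (u : List X) :
    M.wordAct w u = u :=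
  M.wordAct_congr (w' := []) h u

theorem theta_wordRes_of_theta_eq_one {w : List (A × Bool)} (h : M.theta w = 1) (u : List X) :
    M.theta (M.wordRes w u) = 1 :=
  M.theta_wordRes_congr (w' := []) h u

theorem freeAct_theta (w : List (A × Bool)) (u : List X) :
    M.freeAct (M.theta w) u = M.wordAct w u :=
  M.wordAct_congr (M.theta_reducedWord _) u

theorem freeRes_theta (w : List (A × Bool)) (u : List X) :
    M.freeRes (M.theta w) u = M.theta (M.wordRes w u) :=
  M.theta_wordRes_congr (M.theta_reducedWord _) u

/-! ### Fragile words -/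

theorem mem_fragileWords_iff (k : ℕ) (w : List (A × Bool)) :
    w ∈ M.fragileWords k ↔
      ∀ v : List.Vector X k, M.wordAct w v.1 = v.1 ∧ M.theta (M.wordRes w v.1) = 1 := by
  change ((∀ v : List X, v.length = k → (M.toGroup w).1.unop v = v) ∧ _) ↔ _
  simp only [toGroup_unop_apply]
  constructor
  · exact fun h v => ⟨h.1 v.1 v.2, h.2 v.1 v.2.ge⟩
  -- A longer `u` is split after `k` letters: the restriction to the prefix is already trivial in
  -- `F_A`, and remains so.
  · refine fun h => ⟨fun v hv => (h ⟨v, hv⟩).1, fun u hu => ?_⟩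
    rw [← List.take_append_drop k u, wordRes_append]
    exact M.theta_wordRes_of_theta_eq_one (h ⟨u.take k, by simpa using hu⟩).2 _

open Classical in
/-- The transducer that computes the restriction of a word over `A ∪ A⁻¹` to a word of length `k`
over `X`. -/
noncomputable def restrictionTransducer (k : ℕ) :
    FreeTransducer (A × Bool) (List.Vector X k) {s : A // ¬ M.IsSink s} where
  next v a := ⟨M.letterAct a v.1, by simp [v.2]⟩
  out v a :=
    if h : M.IsSink (M.letterRes a v.1).1 then none
    else some (⟨(M.letterRes a v.1).1, h⟩, (M.letterRes a v.1).2)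

theorem foldl_restrictionTransducer_next (k : ℕ) (v : List.Vector X k) (w : List (A × Bool)) :
    (w.foldl (M.restrictionTransducer k).next v).1 = M.wordAct w v.1 := by
  induction w generalizing v with
  | nil => rfl
  | cons a w ih => exact ih _

theorem output_restrictionTransducer (k : ℕ) (v : List.Vector X k) (w : List (A × Bool)) :
    (M.restrictionTransducer k).output v w = M.theta (M.wordRes w v.1) := by
  induction w generalizing v with
  | nil => rfl
  | cons a w ih =>
    rw [FreeTransducer.output, ih, wordRes, theta_cons]
    congr 1
    by_cases h : M.IsSink (M.letterRes a v.1).1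
    · simp [restrictionTransducer, h, FreeGroup.ofOptionLetter, theta]
    · simp [restrictionTransducer, h, FreeGroup.ofOptionLetter, theta]

theorem fragileWords_isDetMultiContextFree [Finite A] [Fintype X] (k : ℕ) :
    (M.fragileWords k).IsDetMultiContextFree (Fintype.card X ^ k) := by
  let e : Fin (Fintype.card X ^ k) ≃ List.Vector X k :=
    (Fintype.equivFinOfCardEq (card_vector k)).symm
  -- The transducer starts at `e i`; ending there again says that `w` fixes this word.
  refine ⟨fun i => {w | w.foldl (M.restrictionTransducer k).next (e i) ∈ ({e i} : Set _) ∧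
    (M.restrictionTransducer k).output (e i) w = 1}, fun i => ?_, fun w => ?_⟩
  · exact (M.restrictionTransducer k).isDetContextFree (e i) {e i}
  · rw [mem_fragileWords_iff, ← e.forall_congr_right]
    refine forall_congr' fun i => ?_
    rw [← foldl_restrictionTransducer_next, ← output_restrictionTransducer]
    exact and_congr_left' Subtype.ext_iff.symm

/-! ### The word problem as the union of the fragile languages -/

theorem fragileWords_le_wordProblem (k : ℕ) : M.fragileWords k ≤ M.wordProblem := by
  intro w hw
  replace hw := (M.mem_fragileWords_iff k w).1 hw
  refine (M.mem_wordProblem_iff w).2 ?_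
  rintro (_ | ⟨x, u⟩)
  · exact List.eq_nil_of_length_eq_zero (M.length_wordAct w [])
  -- Any word is a prefix of a word of length at least `k`.
  set v := (x :: u) ++ List.replicate k x with hv
  have h : M.wordAct w v = v := by
    have hk := hw ⟨v.take k, by simp [hv]; omega⟩
    rw [← List.take_append_drop k v, wordAct_append, hk.1, M.wordAct_of_theta_eq_one hk.2]
  rw [hv, wordAct_append] at h
  exact List.append_inj_left h (M.length_wordAct _ _)

variable {M} in
theorem IsReducible.exists_theta_wordRes_eq_one [Finite X] (hM : M.IsReducible)
    {w : List (A × Bool)} (hw : ∀ u, M.wordAct w u = u) :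
    ∃ k : ℕ, ∀ u : List X, k ≤ u.length → M.theta (M.wordRes w u) = 1 := by
  induction hn : M.len (M.theta w) using Nat.strong_induction_on generalizing w with
  | _ n ih =>
    -- Reducibility needs a fixed letter; over an empty alphabet there is no word of length at least
    -- `1`.
    rcases isEmpty_or_nonempty X with hX | ⟨⟨x⟩⟩
    · refine ⟨1, fun u hu => ?_⟩
      cases u with
      | nil => simp at hu
      | cons x u => exact hX.elim x
    by_cases h1 : M.theta w = 1
    · exact ⟨0, fun u _ => M.theta_wordRes_of_theta_eq_one h1 u⟩
    obtain ⟨m, hm⟩ := hM _ h1 ⟨x, by rw [freeAct_theta, hw]⟩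
    simp only [freeRes_theta, hn] at hm
    have key (v : List.Vector X m) :
        ∃ k : ℕ, ∀ u : List X, k ≤ u.length → M.theta (M.wordRes (M.wordRes w v.1) u) = 1 := by
      refine ih _ (hm v.1 v.2.ge) (fun u => ?_) rfl
      -- The restriction to `v` acts trivially because `w` fixes both `v` and `v ++ u`.
      have h := hw (v.1 ++ u)
      rw [wordAct_append, hw] at h
      exact List.append_cancel_left h
    choose k hk using key
    -- There are finitely many words of length `m`, so their bounds have a common bound `K`.
    obtain ⟨K, hK⟩ := (Set.finite_range k).bddAbove
    refine ⟨m + K, fun u hu => ?_⟩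
    have hl : (u.take m).length = m := by simp; omega
    have hKm : k ⟨u.take m, hl⟩ ≤ K := hK ⟨_, rfl⟩
    rw [← List.take_append_drop m u, wordRes_append]
    exact hk ⟨u.take m, hl⟩ _ (by simp; omega)

variable {M} in
theorem IsReducible.exists_mem_fragileWords [Finite X] (hM : M.IsReducible)
    {w : List (A × Bool)} (hw : w ∈ M.wordProblem) : ∃ k, 0 < k ∧ w ∈ M.fragileWords k := by
  rw [mem_wordProblem_iff] at hw
  obtain ⟨k, hk⟩ := hM.exists_theta_wordRes_eq_one hw
  -- The bound may be `0`, for instance when `θ(w) = 1`, whereas a positive level is required.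
  refine ⟨k + 1, k.succ_pos, ?_⟩
  rw [mem_fragileWords_iff]
  exact fun v => ⟨hw _, hk _ (by have := v.2; omega)⟩

end InvertibleAutomaton

theorem mainTheorem6 {A X : Type*} [Fintype A] [Fintype X] (M : InvertibleAutomaton A X)
    (hM : M.IsReducible) :
    (∀ k : ℕ, 0 < k → (M.fragileWords k).IsDetMultiContextFree (Fintype.card X ^ k)) ∧
      M.wordProblem = ⨆ (k : ℕ) (_ : 0 < k), M.fragileWords k := by
  refine ⟨fun k _ => M.fragileWords_isDetMultiContextFree k, le_antisymm ?_ ?_⟩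
  · intro w hw
    obtain ⟨k, hk, h⟩ := hM.exists_mem_fragileWords hw
    exact le_iSup₂ (f := fun (k : ℕ) (_ : 0 < k) => M.fragileWords k) k hk h
  · exact iSup₂_le fun k _ => M.fragileWords_le_wordProblem k
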